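/- Let $m\ge 2$ be an integer and $\mathcal A=\{0,1,\dots,m-1\}$. Equip the space $\mathcal A^{\mathbb N}$ of infinite words $\omega=\omega_1\omega_2\cdots$ with the metric $d(u,\omega)=m^{-\min\{i\ge1:\,u_i\ne\omega_i\}}$ for $u\neq\omega$, $d(u,u)=0$, and let $\sigma$ be the shift, $(\sigma u)_i=u_{i+1}$. Let $\Sigma\subset\mathcal A^{\mathbb N}$ be a subshift, that is, a closed set with $\sigma(\Sigma)\subset\Sigma$. Let $\Sigma^n$ be the set of prefixes of length $n$ of elements of $\Sigma$, and $\Sigma^*=\bigcup_{n\ge1}\Sigma^n$. Assume that - $\Sigma$ has specification: there is an $M\in\mathbb N$ such that for all $u,v\in\Sigma^*$ there is $w\in\Sigma^M$ with $uwv\in\Sigma^*$; - the topological entropy $h(\Sigma)=\lim_{n\to\infty}\frac1n\log\#\Sigma^n$ is positive; - $0^\infty=000\cdots\in\Sigma$. Put $A=e^{h(\Sigma)}$. Let $\psi:(0,\infty)\to(0,\infty)$ satisfy $\lim_{x\to\infty}\psi(x)=0$, and let $$H_{ea}(\sigma,\psi)=\{\omega\in\Sigma:\ \text{for all sufficiently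 large } N \text{ there is } 1\le n\le N \text{ with } d(\sigma^n\omega,0^\infty)<\psi(N)\}.$$ If $$\limsup_{N\to\infty}\frac{-\log_m\psi(N)}{\log_A N}<+\infty ,$$ then $\dim_{\rm H}H_{ea}(\sigma,\psi)=\dim_{\rm H}\Sigma$, where $\dim_{\rm H}$ denotes Hausdorff dimension with respect to $d$. -/

import Mathlib

open Filter Topology

/-- The space of infinite words over the alphabet `{0, …, m - 1}`. Letters are indexed from `0`, so
the letter `ω_i` of the usual notation (`i ≥ 1`) is `ω.letter (i - 1)`. -/
@[ext]
structure SymbolicSpace (m : ℕ) where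
  letter : ℕ → Fin m

namespace SymbolicSpace

variable {m : ℕ}

open Classical in
/-- The metric `d(u, v) = m ^ (-min {i ≥ 1 : u_i ≠ v_i})` for `u ≠ v`, and `d(u, u) = 0`. With
letters indexed from `0`, the minimum is `PiNat.firstDiff u.letter v.letter + 1`. -/
noncomputable instance : Dist (SymbolicSpace m) where
  dist u v :=
    if u = v then 0
    else ((m : ℝ) ^ (PiNat.firstDiff (E := fun _ => Fin m) u.letter v.letter + 1))⁻¹

theorem dist_of_ne {u v : SymbolicSpace m} (h : u ≠ v) :
    dist u v = ((m : ℝ) ^ (PiNat.firstDiff (E := fun _ => Fin m) u.letter v.letter + 1))⁻¹ := if_neg h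

theorem dist_same (u : SymbolicSpace m) : dist u u = 0 := if_pos rfl

theorem one_le_base (u : SymbolicSpace m) : (1 : ℝ) ≤ m := by
  have h : 0 < m := lt_of_le_of_lt (Nat.zero_le _) (u.letter 0).isLt
  exact_mod_cast h

theorem dist_nonneg_aux (u v : SymbolicSpace m) : 0 ≤ dist u v := by
  by_cases h : u = v
  · rw [h, dist_same]
  · rw [dist_of_ne h]; positivity

theorem dist_triangle_aux (u v w : SymbolicSpace m) : dist u w ≤ dist u v + dist v w := by
  by_cases huw : u = w
  · rw [huw, dist_same]
    exact add_nonneg (dist_nonneg_aux _ _) (dist_nonneg_aux _ _)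
  by_cases huv : u = v
  · rw [huv, dist_same, zero_add]
  by_cases hvw : v = w
  · rw [hvw, dist_same, add_zero]
  have hm := one_le_base u
  have key : ∀ {a b : ℕ}, a ≤ b → ((m : ℝ) ^ (b + 1))⁻¹ ≤ ((m : ℝ) ^ (a + 1))⁻¹ := by
    intro a b hab
    have hpos : (0 : ℝ) < (m : ℝ) ^ (a + 1) := by positivity
    exact inv_anti₀ hpos (pow_le_pow_right₀ hm (by omega))
  have hmin := PiNat.min_firstDiff_le (E := fun _ => Fin m) u.letter v.letter w.letter
    fun h => huw (SymbolicSpace.ext h)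
  rcases min_le_iff.1 hmin with h | h
  · have h1 : dist u w ≤ dist u v := by
      rw [dist_of_ne huw, dist_of_ne huv]; exact key h
    linarith [dist_nonneg_aux v w]
  · have h1 : dist u w ≤ dist v w := by
      rw [dist_of_ne huw, dist_of_ne hvw]; exact key h
    linarith [dist_nonneg_aux u v]

noncomputable instance : MetricSpace (SymbolicSpace m) where
  dist_self := dist_same
  dist_comm u v := by
    by_cases h : u = v
    · rw [h]
    · rw [dist_of_ne h, dist_of_ne (Ne.symm h), PiNat.firstDiff_comm]
  dist_triangle := dist_triangle_aux
  eq_of_dist_eq_zero := by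
    intro u v huv
    by_contra h
    rw [dist_of_ne h] at huv
    have hm := one_le_base u
    have : (0 : ℝ) < ((m : ℝ) ^ (PiNat.firstDiff (E := fun _ => Fin m) u.letter v.letter + 1))⁻¹ := by positivity
    linarith

/-- The shift map `(σ u)_i = u_{i+1}`. -/
def shift (u : SymbolicSpace m) : SymbolicSpace m := ⟨fun i => u.letter (i + 1)⟩

/-- The infinite word `0^∞`. -/
def zeroWord (m : ℕ) [NeZero m] : SymbolicSpace m := ⟨fun _ => 0⟩

/-- The prefix of length `n` of an infinite word. -/
def initialWord (n : ℕ) (u : SymbolicSpace m) : List (Fin m) := List.ofFn fun i : Fin n => u.letter i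

/-- A subshift: a closed set `S` of infinite words with `σ(S) ⊆ S`. -/
structure IsSubshift (S : Set (SymbolicSpace m)) : Prop where
  isClosed : IsClosed S
  shift_mem : ∀ u ∈ S, shift u ∈ S

/-- `Σ^n`: the prefixes of length `n` of the elements of `S`. -/
def words (S : Set (SymbolicSpace m)) (n : ℕ) : Set (List (Fin m)) := initialWord n '' S

/-- `Σ^*`: the nonempty finite words of `S`. -/
def language (S : Set (SymbolicSpace m)) : Set (List (Fin m)) := {w | ∃ n, 1 ≤ n ∧ w ∈ words S n}

/-- The specification property: there is a gap length `M` such that any two words `u`, `v` of `S`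
can be joined to a word `u w v` of `S` by some word `w` of `S` of length exactly `M`. -/
def HasSpecification (S : Set (SymbolicSpace m)) : Prop :=
  ∃ M : ℕ, ∀ u ∈ language S, ∀ v ∈ language S, ∃ w ∈ words S M, u ++ w ++ v ∈ language S

/-- The topological entropy `h(S) = lim (log #Σ^n) / n`; for a subshift the limit exists, by
`tendsto_topologicalEntropy`. -/
noncomputable def topologicalEntropy (S : Set (SymbolicSpace m)) : ℝ :=
  limUnder atTop fun n : ℕ => Real.log ((words S n).ncard : ℝ) / n

theorem words_finite (S : Set (SymbolicSpace m)) (n : ℕ) : (words S n).Finite := by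
  refine (Set.finite_range fun f : Fin n → Fin m => List.ofFn f).subset ?_
  rintro _ ⟨u, -, rfl⟩
  exact ⟨fun i => u.letter i, rfl⟩

theorem shift_iterate_apply (k i : ℕ) (u : SymbolicSpace m) : (shift^[k] u).letter i = u.letter (i + k) := by
  induction k generalizing u with
  | zero => rfl
  | succ k ih =>
    rw [Function.iterate_succ_apply, ih]
    change u.letter (i + k + 1) = u.letter (i + (k + 1))
    rw [Nat.add_assoc]

theorem IsSubshift.iterate_mem {S : Set (SymbolicSpace m)} (hS : IsSubshift S) (k : ℕ)
    {u : SymbolicSpace m} (hu : u ∈ S) : shift^[k] u ∈ S := by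
  induction k with
  | zero => exact hu
  | succ k ih => rw [Function.iterate_succ_apply']; exact hS.shift_mem _ ih

theorem IsSubshift.ncard_words_add_le {S : Set (SymbolicSpace m)} (hS : IsSubshift S) (i j : ℕ) :
    (words S (i + j)).ncard ≤ (words S i).ncard * (words S j).ncard := by
  have hsub : words S (i + j) ⊆ (fun p : List (Fin m) × List (Fin m) => p.1 ++ p.2) ''
      (words S i ×ˢ words S j) := by
    rintro _ ⟨u, hu, rfl⟩
    refine ⟨(initialWord i u, initialWord j (shift^[i] u)),
      ⟨⟨u, hu, rfl⟩, ⟨_, hS.iterate_mem i hu, rfl⟩⟩, ?_⟩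
    simp only [initialWord, List.ofFn_add, shift_iterate_apply]
    congr 2
    funext k
    simp [Nat.add_comm]
  have hfin := (words_finite S i).prod (words_finite S j)
  calc (words S (i + j)).ncard ≤ _ := Set.ncard_le_ncard hsub (hfin.image _)
    _ ≤ (words S i ×ˢ words S j).ncard := Set.ncard_image_le hfin
    _ = _ := Set.ncard_prod

/-- For a subshift, the limit that defines the entropy exists. -/
theorem IsSubshift.tendsto_topologicalEntropy {S : Set (SymbolicSpace m)} (hS : IsSubshift S) :
    Tendsto (fun n : ℕ => Real.log ((words S n).ncard : ℝ) / n) atTop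
      (𝓝 (topologicalEntropy S)) := by
  have hsub : Subadditive fun n : ℕ => Real.log ((words S n).ncard : ℝ) := by
    intro i j
    beta_reduce
    have h := hS.ncard_words_add_le i j
    rcases Nat.eq_zero_or_pos (words S (i + j)).ncard with h0 | h0
    · rw [h0, Nat.cast_zero, Real.log_zero]
      exact add_nonneg (Real.log_natCast_nonneg _) (Real.log_natCast_nonneg _)
    · have hp : 0 < (words S i).ncard * (words S j).ncard := lt_of_lt_of_le h0 h
      have hi : (words S i).ncard ≠ 0 := fun h => by simp [h] at hp
      have hj : (words S j).ncard ≠ 0 := fun h => by simp [h] at hp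
      rw [← Real.log_mul (by exact_mod_cast hi) (by exact_mod_cast hj)]
      exact Real.log_le_log (by exact_mod_cast h0) (by exact_mod_cast h)
  refine tendsto_nhds_limUnder ⟨hsub.lim, hsub.tendsto_lim ⟨0, ?_⟩⟩
  rintro _ ⟨n, rfl⟩
  exact div_nonneg (Real.log_natCast_nonneg _) (Nat.cast_nonneg _)

/-- The points `x ∈ X` that eventually always hit the targets `E_N`: for every large enough `N` there
is `1 ≤ n ≤ N` with `T^n x ∈ E_N`. -/
def eventuallyAlwaysHitting {α : Type*} (X : Set α) (T : α → α) (E : ℕ → Set α) : Set α :=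
  {x ∈ X | ∀ᶠ N in atTop, ∃ n, 1 ≤ n ∧ n ≤ N ∧ T^[n] x ∈ E N}

/-- The set `H_ea(σ, ψ)`, with the balls `E_N = {ω ∈ S : d(ω, 0^∞) < ψ(N)}` as targets. -/
noncomputable def hittingSet [NeZero m] (S : Set (SymbolicSpace m)) (ψ : ℝ → ℝ) :
    Set (SymbolicSpace m) :=
  eventuallyAlwaysHitting S shift fun N => {ω ∈ S | dist ω (zeroWord m) < ψ N}

end SymbolicSpace

namespace SymbolicSpace

/-! The limsup condition makes `ψ N` eventually larger than some `N ^ (-t)`, so zero blocks of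
length about `2 * t * k` at positions about `2 ^ k` suffice to hit all late targets. By
specification such blocks can be inserted into any point of `S`, with gaps of length `M` on both
sides (`exists_subword_eq`, `mem_hittingSet`). The first `k` insertions have total length `O(k ^
2)`, negligible against `2 ^ k`. Hence deleting them is an `r`-Hölder map for every `r < 1`
(`holderWith_subword`). It maps the hitting set onto a superset of `S`, so `dimH S ≤ dimH
(hittingSet S ψ) / r`; let `r → 1`. -/

/-! ### Gluing by specification -/

theorem exists_mem_prefix_append {m : ℕ} {S : Set (SymbolicSpace m)} {M : ℕ}
    (hM : ∀ u ∈ language S, ∀ v ∈ language S, ∃ w ∈ words S M, u ++ w ++ v ∈ language S)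
    {z x : SymbolicSpace m} (hz : z ∈ S) (hx : x ∈ S) {n a : ℕ} (hn : 1 ≤ n) (ha : 1 ≤ a) :
    ∃ y ∈ S, (∀ i < n, y.letter i = z.letter i) ∧
      ∀ i < a, y.letter (n + M + i) = x.letter i := by
  obtain ⟨w, ⟨w', -, rfl⟩, L, -, y, hy, hyL⟩ :=
    hM (initialWord n z) ⟨n, hn, z, hz, rfl⟩ (initialWord a x) ⟨a, ha, x, hx, rfl⟩
  have hL : L = n + M + a := by
    have h := congrArg List.length hyL
    simpa [initialWord, Nat.add_assoc] using h
  subst hL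
  have hget : ∀ i : ℕ, (initialWord (n + M + a) y)[i]? =
      (initialWord n z ++ initialWord M w' ++ initialWord a x)[i]? := fun i => by rw [hyL]
  refine ⟨y, hy, fun i hi => ?_, fun i hi => ?_⟩
  · have h := hget i
    rw [List.append_assoc, List.getElem?_append_left (by simpa [initialWord] using hi)] at h
    simpa [initialWord, hi, show i < n + M + a by omega] using h
  · have h := hget (n + M + i)
    rw [List.getElem?_append_right (by simp [initialWord])] at h
    simpa [initialWord, hi] using h

theorem dist_le_of_forall_lt {m : ℕ} {u v : SymbolicSpace m} {n : ℕ}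
    (h : ∀ i < n, u.letter i = v.letter i) : dist u v ≤ ((m : ℝ) ^ (n + 1))⁻¹ := by
  by_cases huv : u = v
  · rw [huv, dist_self]
    positivity
  rw [dist_of_ne huv]
  have hne : u.letter ≠ v.letter := fun h => huv (SymbolicSpace.ext h)
  have hn : n ≤ PiNat.firstDiff (E := fun _ => Fin m) u.letter v.letter := by
    by_contra! hlt
    exact PiNat.apply_firstDiff_ne (E := fun _ => Fin m) hne (h _ hlt)
  have hm := one_le_base u
  exact inv_anti₀ (by positivity) (pow_le_pow_right₀ hm (by omega))

theorem le_dist_of_letter_ne {m : ℕ} {u v : SymbolicSpace m} {n : ℕ}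
    (h : u.letter n ≠ v.letter n) : ((m : ℝ) ^ (n + 1))⁻¹ ≤ dist u v := by
  have huv : u ≠ v := fun e => h (e ▸ rfl)
  rw [dist_of_ne huv]
  have hn : PiNat.firstDiff (E := fun _ => Fin m) u.letter v.letter ≤ n := by
    by_contra! hlt
    exact h (PiNat.apply_eq_of_lt_firstDiff (E := fun _ => Fin m) hlt)
  have hm := one_le_base u
  exact inv_anti₀ (by positivity) (pow_le_pow_right₀ hm (by omega))

theorem mem_of_forall_prefix {m : ℕ} (hm : 2 ≤ m) {S : Set (SymbolicSpace m)} (hS : IsClosed S)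
    {y : SymbolicSpace m} (h : ∀ n, ∃ z ∈ S, ∀ i < n, y.letter i = z.letter i) : y ∈ S := by
  rw [← hS.closure_eq, Metric.mem_closure_iff]
  intro ε hε
  have hm' : (1 : ℝ) < m := by exact_mod_cast hm
  obtain ⟨n, hn⟩ := exists_pow_lt_of_lt_one hε (inv_lt_one_of_one_lt₀ hm')
  obtain ⟨z, hz, hyz⟩ := h n
  refine ⟨z, hz, (dist_le_of_forall_lt hyz).trans_lt (lt_of_le_of_lt ?_ hn)⟩
  rw [inv_pow]
  exact inv_anti₀ (by positivity) (pow_le_pow_right₀ hm'.le (by omega))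

/-- Prefixes of prescribed lengths of points of a subshift with specification occur, separated by
gaps of constant length, in a point of the subshift. -/
theorem exists_mem_concat {m : ℕ} (hm : 2 ≤ m) {S : Set (SymbolicSpace m)} (hS : IsClosed S)
    {M : ℕ} (hM : ∀ u ∈ language S, ∀ v ∈ language S, ∃ w ∈ words S M, u ++ w ++ v ∈ language S)
    {x : ℕ → SymbolicSpace m} (hx : ∀ k, x k ∈ S) {a p : ℕ → ℕ} (ha : ∀ k, 1 ≤ a k)
    (hp0 : p 0 = 0) (hp : ∀ k, p (k + 1) = p k + a k + M) :
    ∃ y ∈ S, ∀ k, ∀ i < a k, y.letter (p k + i) = (x k).letter i := by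
  choose! f hfS hfl hfr using fun (z : SymbolicSpace m) (k : ℕ) (hz : z ∈ S) =>
    exists_mem_prefix_append hM hz (hx (k + 1)) (n := p k + a k)
      (le_trans (ha k) (Nat.le_add_left _ _)) (ha (k + 1))
  -- `z k` carries blocks `0, …, k`; its tail after block `k` is discarded at the next step.
  let z : ℕ → SymbolicSpace m := fun k => Nat.rec (x 0) (fun k z => f z k) k
  have hzS : ∀ k, z k ∈ S := fun k => Nat.rec (hx 0) (fun k h => hfS _ k h) k
  have hstep : ∀ k, ∀ i < p k + a k, (z (k + 1)).letter i = (z k).letter i :=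
    fun k => hfl (z k) k (hzS k)
  have hmono : Monotone fun k => p k + a k :=
    monotone_nat_of_le_succ fun k => by have := hp k; omega
  have hagree : ∀ k l, k ≤ l → ∀ i < p k + a k, (z l).letter i = (z k).letter i := by
    intro k l hkl
    induction l, hkl using Nat.le_induction with
    | base => exact fun _ _ => rfl
    | succ l hl ih => exact fun i hi => (hstep l i (hi.trans_le (hmono hl))).trans (ih i hi)
  have hblock : ∀ k, ∀ i < a k, (z k).letter (p k + i) = (x k).letter i := by
    rintro (_ | k) i hi
    · rw [hp0, Nat.zero_add]; rfl
    · rw [hp]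
      exact hfr (z k) k (hzS k) i hi
  have hlarge : ∀ k, k < p k + a k := by
    intro k
    induction k with
    | zero => have := ha 0; omega
    | succ k ih => have := ha (k + 1); have := hp k; omega
  -- The limit is the diagonal `i ↦ (z i).letter i`, since letter `i` is final from `z i` on.
  have hy : ∀ k, ∀ i < p k + a k, (z i).letter i = (z k).letter i := by
    intro k i hi
    rcases le_total k i with h | h
    · exact hagree k i h i hi
    · exact (hagree i k h i (hlarge i)).symm
  refine ⟨⟨fun i => (z i).letter i⟩, mem_of_forall_prefix hm hS fun n =>
    ⟨z n, hzS n, fun i hi => hy n i (hi.trans (hlarge n))⟩, fun k i hi => ?_⟩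
  exact (hy k _ (by omega)).trans (hblock k i hi)

/-! ### Deletion of letters -/

/-- The word formed by the letters of `u` at the positions `φ 0, φ 1, …`. -/
def subword {m : ℕ} (φ : ℕ → ℕ) (u : SymbolicSpace m) : SymbolicSpace m :=
  ⟨fun n => u.letter (φ n)⟩

/-- If the images first differ at `n`, the originals differ at `φ n`, so their distance is at least
`m ^ (-(φ n + 1))`. -/
theorem holderWith_subword {m : ℕ} (hm : 2 ≤ m) {φ : ℕ → ℕ} {r : NNReal} {C : ℕ}
    (h : ∀ n, (r : ℝ) * (φ n + 1) ≤ n + 1 + C) :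
    HolderWith ((m : NNReal) ^ C) r (subword (m := m) φ) := by
  intro u v
  have key : dist (subword φ u) (subword φ v) ≤ (m : ℝ) ^ C * dist u v ^ (r : ℝ) := by
    by_cases huv : subword φ u = subword φ v
    · rw [huv, dist_self]
      positivity
    have hm' : (1 : ℝ) < m := by exact_mod_cast hm
    have hm0 : (0 : ℝ) < m := by linarith
    have hne := PiNat.apply_firstDiff_ne (E := fun _ => Fin m)
      (fun h => huv (SymbolicSpace.ext h) : (subword φ u).letter ≠ (subword φ v).letter)
    rw [dist_of_ne huv]
    set n := PiNat.firstDiff (E := fun _ => Fin m) (subword φ u).letter (subword φ v).letter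
    have hd : ((m : ℝ) ^ (φ n + 1))⁻¹ ≤ dist u v := le_dist_of_letter_ne hne
    calc ((m : ℝ) ^ (n + 1))⁻¹ = (m : ℝ) ^ (-((n : ℝ) + 1)) := by
          rw [Real.rpow_neg hm0.le]; norm_cast
      _ ≤ (m : ℝ) ^ ((C : ℝ) + -(r * (φ n + 1))) :=
          Real.rpow_le_rpow_of_exponent_le hm'.le (by linarith [h n])
      _ = (m : ℝ) ^ C * (((m : ℝ) ^ (φ n + 1))⁻¹) ^ (r : ℝ) := by
          rw [Real.rpow_add hm0, Real.rpow_natCast, Real.rpow_neg hm0.le, mul_comm (r : ℝ),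
            Real.rpow_mul hm0.le, Real.inv_rpow (by positivity)]
          norm_cast
      _ ≤ (m : ℝ) ^ C * dist u v ^ (r : ℝ) := by gcongr
  rw [edist_nndist, edist_nndist, ← ENNReal.coe_rpow_of_nonneg _ r.coe_nonneg]
  exact_mod_cast key

/-! ### Length of the insertions -/

/-- The total length of the first `k` inserted segments, the `j`-th of which consists of two gaps of
length `M` and a block of length `K * (j + 1)`. -/
def insertedLength (M K k : ℕ) : ℕ := ∑ j ∈ Finset.range k, (2 * M + K * (j + 1))

theorem insertedLength_le (M K k : ℕ) : insertedLength M K k ≤ (2 * M + K) * k ^ 2 := by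
  calc insertedLength M K k ≤ ∑ _j ∈ Finset.range k, (2 * M + K) * k := by
        refine Finset.sum_le_sum fun j hj => ?_
        have hj' : j + 1 ≤ k := Finset.mem_range.1 hj
        nlinarith [Nat.mul_le_mul_left K hj', Nat.mul_le_mul_left (2 * M) hj']
    _ = (2 * M + K) * k ^ 2 := by
        rw [Finset.sum_const, Finset.card_range, smul_eq_mul]; ring

theorem eventually_insertedLength_le (M K : ℕ) {ε : ℝ} (hε : 0 < ε) :
    ∀ᶠ k in atTop, (insertedLength M K k : ℝ) ≤ ε * 2 ^ k := by
  have h := (tendsto_pow_const_div_const_pow_of_one_lt 2 (one_lt_two (α := ℝ))).const_mul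
    ((2 * M + K : ℕ) : ℝ)
  rw [mul_zero] at h
  filter_upwards [h.eventually_le_const hε] with k hk
  rw [← mul_div_assoc, div_le_iff₀ (by positivity)] at hk
  exact le_trans (by exact_mod_cast insertedLength_le M K k) hk

/-- The position of the letter `n` after the insertion of segments in front of the letters
`2 ^ k - 1`, `k ≥ 1`. -/
def shiftedPosition (M K n : ℕ) : ℕ := n + insertedLength M K (Nat.log 2 (n + 1))

/-- For large `k` the inserted length is at most `(1 - r) * 2 ^ k ≤ (1 - r) * (n + 1)`; `C` absorbs
the small `k`. -/
theorem exists_mul_shiftedPosition_le (M K : ℕ) {r : NNReal} (hr : r < 1) :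
    ∃ C : ℕ, ∀ n, (r : ℝ) * (shiftedPosition M K n + 1) ≤ n + 1 + C := by
  have hr' : (r : ℝ) < 1 := by exact_mod_cast hr
  obtain ⟨k₀, hk₀⟩ := eventually_atTop.1
    (eventually_insertedLength_le M K (sub_pos.2 hr'))
  refine ⟨(2 * M + K) * k₀ ^ 2, fun n => ?_⟩
  set k := Nat.log 2 (n + 1) with hk
  have hpos : (shiftedPosition M K n : ℝ) = n + insertedLength M K k := by
    rw [shiftedPosition]; push_cast; rfl
  have h2 : ((2 : ℝ) ^ k) ≤ n + 1 := by exact_mod_cast Nat.pow_log_le_self 2 (Nat.succ_ne_zero n)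
  have hr0 : (0 : ℝ) ≤ r := r.coe_nonneg
  have hI : (0 : ℝ) ≤ insertedLength M K k := Nat.cast_nonneg _
  rw [hpos]
  rcases le_total k₀ k with h | h
  · have h1 := hk₀ k h
    have hC : (0 : ℝ) ≤ ((2 * M + K) * k₀ ^ 2 : ℕ) := Nat.cast_nonneg _
    nlinarith
  · have h1 : (insertedLength M K k : ℝ) ≤ ((2 * M + K) * k₀ ^ 2 : ℕ) := by
      exact_mod_cast (insertedLength_le M K k).trans (by gcongr)
    nlinarith [(Nat.cast_nonneg n : (0 : ℝ) ≤ n)]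

/-- Every point of a subshift with specification that contains `0^∞` is a subword of a point of the
subshift with long blocks of zeros at prescribed positions. -/
theorem exists_subword_eq {m : ℕ} [NeZero m] (hm : 2 ≤ m) {S : Set (SymbolicSpace m)}
    (hS : IsSubshift S) {M : ℕ}
    (hM : ∀ u ∈ language S, ∀ v ∈ language S, ∃ w ∈ words S M, u ++ w ++ v ∈ language S)
    (hzero : zeroWord m ∈ S) {K : ℕ} (hK : 1 ≤ K) {x : SymbolicSpace m} (hx : x ∈ S) :
    ∃ y ∈ S, subword (shiftedPosition M K) y = x ∧ ∀ k, ∀ i < K * (k + 1),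
      y.letter (2 ^ (k + 1) - 1 + insertedLength M K k + M + i) = 0 := by
  -- Piece `2 * k` is the dyadic block of `x` on `[2 ^ k - 1, 2 ^ (k + 1) - 1)`; piece `2 * k + 1`
  -- is the `k`-th zero block.
  let a : ℕ → ℕ := fun j => if Even j then 2 ^ (j / 2) else K * (j / 2 + 1)
  let p : ℕ → ℕ := fun j => if Even j then 2 ^ (j / 2) - 1 + insertedLength M K (j / 2)
    else 2 ^ (j / 2 + 1) - 1 + insertedLength M K (j / 2) + M
  let b : ℕ → SymbolicSpace m := fun j =>
    if Even j then shift^[2 ^ (j / 2) - 1] x else zeroWord m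
  have hdiv (k : ℕ) : (2 * k + 1) / 2 = k := by omega
  have hpow (k : ℕ) : 1 ≤ 2 ^ k := Nat.one_le_two_pow
  obtain ⟨y, hy, h⟩ := exists_mem_concat hm hS.isClosed hM (x := b) (a := a) (p := p)
    (fun j => by
      rcases Nat.even_or_odd' j with ⟨k, rfl | rfl⟩
      · simpa [b] using hS.iterate_mem _ hx
      · simpa [b] using hzero)
    (fun j => by
      rcases Nat.even_or_odd' j with ⟨k, rfl | rfl⟩
      · simpa [a] using hpow k
      · simpa [a, hdiv, Nat.one_le_iff_ne_zero, Nat.pos_iff_ne_zero] using hK)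
    (by simp [p, insertedLength])
    (fun j => by
      rcases Nat.even_or_odd' j with ⟨k, rfl | rfl⟩
      · have := hpow k
        simp only [p, a, even_two_mul, Nat.not_even_two_mul_add_one, if_true, if_false, hdiv,
          Nat.mul_div_cancel_left k two_pos, pow_succ]
        omega
      · have := hpow (k + 1)
        have he : 2 * k + 1 + 1 = 2 * (k + 1) := by ring
        simp only [he, p, a, even_two_mul, Nat.not_even_two_mul_add_one, if_true, if_false, hdiv,
          Nat.mul_div_cancel_left _ two_pos, insertedLength, Finset.sum_range_succ]
        omega)
  refine ⟨y, hy, SymbolicSpace.ext (funext fun n => ?_), fun k i hi => ?_⟩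
  · have hlo := Nat.pow_log_le_self 2 (Nat.succ_ne_zero n)
    have hhi := Nat.lt_pow_succ_log_self one_lt_two (n + 1)
    have := h (2 * Nat.log 2 (n + 1)) (n - (2 ^ Nat.log 2 (n + 1) - 1))
    simp only [p, a, b, even_two_mul, if_true, Nat.mul_div_cancel_left _ two_pos,
      shift_iterate_apply] at this
    simp only [Nat.succ_eq_add_one, pow_succ] at hlo hhi
    have h1 := hpow (Nat.log 2 (n + 1))
    have := this (by omega)
    rw [Nat.sub_add_cancel (by omega)] at this
    rw [← this]
    change y.letter (shiftedPosition M K n) = _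
    congr 1
    rw [shiftedPosition]
    omega
  · have := h (2 * k + 1) i
    simp only [p, a, b, Nat.not_even_two_mul_add_one, if_false, hdiv] at this
    exact this hi

/-! ### Hitting the targets -/

theorem exists_eventually_inv_pow_lt {m : ℕ} (hm : 2 ≤ m) {h : ℝ} (hh : 0 < h) {ψ : ℝ → ℝ}
    (hψpos : ∀ x, 0 < x → 0 < ψ x)
    (hψ : limsup (fun N : ℕ =>
        ((-Real.logb m (ψ N) / Real.logb (Real.exp h) N : ℝ) : EReal)) atTop < ⊤) :
    ∃ t : ℕ, ∀ᶠ N : ℕ in atTop, ((N : ℝ) ^ t)⁻¹ < ψ N := by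
  obtain ⟨c, hc, -⟩ := EReal.lt_iff_exists_real_btwn.1 hψ
  have hlm : 0 < Real.log m := Real.log_pos (by exact_mod_cast hm)
  -- A ratio below `c` means `ψ N > N ^ (-(c * log m / h))`.
  obtain ⟨t, ht⟩ := exists_nat_ge (c * Real.log m / h)
  refine ⟨t, ?_⟩
  filter_upwards [eventually_lt_of_limsup_lt hc, eventually_ge_atTop 2] with N hN hN2
  have hN' : -Real.logb m (ψ N) / Real.logb (Real.exp h) N < c := by exact_mod_cast hN
  have hN0 : (0 : ℝ) < N := by exact_mod_cast (by omega : 0 < N)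
  have hlN : 0 < Real.log N := Real.log_pos (by exact_mod_cast hN2)
  rw [Real.logb, Real.logb, Real.log_exp, div_lt_iff₀ (by positivity), ← neg_div,
    div_lt_iff₀ hlm] at hN'
  rw [← Real.log_lt_log_iff (by positivity) (hψpos _ hN0), Real.log_inv, Real.log_pow]
  have h1 : c * (Real.log N / h) * Real.log m = c * Real.log m / h * Real.log N := by ring
  have h2 := mul_le_mul_of_nonneg_right ht hlN.le
  linarith

/-- A point with blocks of zeros of length `(2 * t + 1) * (k + 1)` at the positions where
`exists_subword_eq` provides them eventually always hits targets shrinking polynomially. -/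
theorem mem_hittingSet {m : ℕ} [NeZero m] (hm : 2 ≤ m) {S : Set (SymbolicSpace m)}
    (hS : IsSubshift S) {ψ : ℝ → ℝ} {t M : ℕ}
    (ht : ∀ᶠ N : ℕ in atTop, ((N : ℝ) ^ t)⁻¹ < ψ N) {y : SymbolicSpace m} (hy : y ∈ S)
    (hz : ∀ k, ∀ i < (2 * t + 1) * (k + 1),
      y.letter (2 ^ (k + 1) - 1 + insertedLength M (2 * t + 1) k + M + i) = 0) :
    y ∈ hittingSet S ψ := by
  set q : ℕ → ℕ := fun k => 2 ^ (k + 1) - 1 + insertedLength M (2 * t + 1) k + M with hq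
  have hpow (k : ℕ) : k < 2 ^ k := Nat.lt_two_pow_self
  have hqk (k : ℕ) : k + 1 ≤ q k := by have := hpow (k + 1); simp only [hq]; omega
  obtain ⟨k₀, hk₀⟩ := eventually_atTop.1
    (eventually_insertedLength_le M (2 * t + 1) one_pos)
  -- For `q k ≤ N < q (k + 1)` this gives `N ^ t ≤ 2 ^ (2 * t * (k + 1))`, hence the factor `2 * t`
  -- in the block length; the `+ 1` keeps blocks nonempty when `t = 0`.
  have hbound (k : ℕ) (h0 : k₀ ≤ k) (hMk : M + 3 ≤ k) : q (k + 1) ≤ 2 ^ (2 * (k + 1)) := by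
    have h1 : insertedLength M (2 * t + 1) (k + 1) ≤ 2 ^ (k + 1) := by
      have := hk₀ (k + 1) (by omega)
      rw [one_mul] at this
      exact_mod_cast this
    have h2 := hpow (k + 1)
    have h3 : 4 * 2 ^ (k + 1) ≤ 2 ^ (k + 1) * 2 ^ (k + 1) :=
      Nat.mul_le_mul_right _ (by omega)
    have h4 : 2 ^ (2 * (k + 1)) = 2 ^ (k + 1) * 2 ^ (k + 1) := by rw [two_mul, pow_add]
    have h5 : 2 ^ (k + 1 + 1) = 2 * 2 ^ (k + 1) := by rw [pow_succ, mul_comm]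
    simp only [hq]
    omega
  refine ⟨hy, ?_⟩
  filter_upwards [ht, eventually_ge_atTop (q (k₀ + M + 3))] with N hN hNq
  have hmono : Monotone q := monotone_nat_of_le_succ fun k => by
    have h5 : 2 ^ (k + 1 + 1) = 2 * 2 ^ (k + 1) := by rw [pow_succ, mul_comm]
    simp only [hq, insertedLength, Finset.sum_range_succ]
    omega
  have hex : ∃ k, N < q k := ⟨N, (Nat.lt_succ_self N).trans_le (hqk N)⟩
  classical
  -- The hit occurs at the start `q k` of the last zero block beginning by time `N`.
  obtain ⟨k, hk, hlt⟩ : ∃ k, q k ≤ N ∧ N < q (k + 1) := by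
    have hspec := Nat.find_spec hex
    rcases hj : Nat.find hex with _ | k
    · rw [hj] at hspec
      exact absurd ((hmono (Nat.zero_le _)).trans hNq) hspec.not_ge
    · exact ⟨k, not_lt.1 (Nat.find_min hex (hj ▸ Nat.lt_succ_self k)), hj ▸ hspec⟩
  have hkk : k₀ + M + 3 ≤ k := by
    by_contra! hcon
    have := hmono (show k + 1 ≤ k₀ + M + 3 by omega)
    omega
  refine ⟨q k, (Nat.succ_le_succ (Nat.zero_le k)).trans (hqk k), hk, hS.iterate_mem _ hy, ?_⟩
  have hdist : dist (shift^[q k] y) (zeroWord m) ≤ ((m : ℝ) ^ ((2 * t + 1) * (k + 1) + 1))⁻¹ :=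
    dist_le_of_forall_lt fun i hi => by
      rw [shift_iterate_apply, Nat.add_comm]
      exact hz k i hi
  refine hdist.trans_lt (lt_of_le_of_lt (inv_anti₀ ?_ ?_) hN)
  · have : 0 < N := by have := hqk k; omega
    positivity
  · have h1 : N ^ t ≤ (2 ^ (2 * (k + 1))) ^ t :=
      Nat.pow_le_pow_left (hlt.le.trans (hbound k (by omega) (by omega))) t
    have h2 : (2 ^ (2 * (k + 1))) ^ t ≤ 2 ^ ((2 * t + 1) * (k + 1) + 1) := by
      rw [← pow_mul]
      exact Nat.pow_le_pow_right two_pos (by nlinarith)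
    exact_mod_cast (h1.trans h2).trans (Nat.pow_le_pow_left hm _)

end SymbolicSpace

open SymbolicSpace in
theorem corollary1p3 (m : ℕ) [NeZero m] (hm : 2 ≤ m) (S : Set (SymbolicSpace m))
    (hS : SymbolicSpace.IsSubshift S) (hspec : SymbolicSpace.HasSpecification S)
    (hent : 0 < SymbolicSpace.topologicalEntropy S) (hzero : SymbolicSpace.zeroWord m ∈ S)
    (ψ : ℝ → ℝ) (hψpos : ∀ x, 0 < x → 0 < ψ x) (hψlim : Tendsto ψ atTop (𝓝 0))
    (hψ : limsup (fun N : ℕ =>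
        ((-Real.logb m (ψ N) / Real.logb (Real.exp (SymbolicSpace.topologicalEntropy S)) N : ℝ) :
          EReal)) atTop < ⊤) :
    dimH (SymbolicSpace.hittingSet S ψ) = dimH S := by
  refine le_antisymm (dimH_mono fun _ h => h.1) ?_
  obtain ⟨M, hM⟩ := hspec
  obtain ⟨t, ht⟩ := exists_eventually_inv_pow_lt hm hent hψpos hψ
  have hsub : S ⊆ subword (shiftedPosition M (2 * t + 1)) '' hittingSet S ψ := by
    intro x hx
    obtain ⟨y, hy, hyx, hyz⟩ := exists_subword_eq hm hS hM hzero (K := 2 * t + 1) (by omega) hx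
    exact ⟨y, mem_hittingSet hm hS ht hy hyz, hyx⟩
  have hr (r : NNReal) (h0 : 0 < r) (h1 : r < 1) : dimH S ≤ dimH (hittingSet S ψ) / r := by
    obtain ⟨C, hC⟩ := exists_mul_shiftedPosition_le M (2 * t + 1) h1
    exact (dimH_mono hsub).trans ((holderWith_subword hm hC).dimH_image_le h0 _)
  have hlim : Tendsto (fun r : NNReal => dimH (hittingSet S ψ) / (r : ENNReal)) (𝓝[<] 1)
      (𝓝 (dimH (hittingSet S ψ) / (1 : NNReal))) :=
    ENNReal.Tendsto.const_div
      ((ENNReal.continuous_coe.tendsto 1).mono_left nhdsWithin_le_nhds) (Or.inl (by simp))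
  rw [ENNReal.coe_one, div_one] at hlim
  have : (𝓝[<] (1 : NNReal)).NeBot := nhdsLT_neBot_of_exists_lt ⟨0, one_pos⟩
  refine ge_of_tendsto hlim ?_
  filter_upwards [Ioo_mem_nhdsLT (zero_lt_one (α := NNReal))] with r h
  exact hr r h.1 h.2
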